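/- Conventions. The variety generated by a class of groups is the class of all groups satisfying every law (word identity) that holds in all groups of the class; $\operatorname{var}(G)$ is the variety generated by a single group $G$. The product $\mathfrak U\mathfrak V$ of two varieties is the class of all groups $K$ having a normal subgroup $N\in\mathfrak U$ with $K/N\in\mathfrak V$. A critical group is a finite group $K$ that does not lie in the variety generated by its proper factors, i.e. by the groups $H/L$ with $L\trianglelefteq H\le K$ and $(H,L)\neq(K,1)$. The exponent of a group $G$ is the least $e\ge 1$ with $g^e=1$ for all $g\in G$, and is $0$ if there is no such $e$. Lemma. Let $A$ be a nilpotent group of nilpotency class $c$ and of exponent $m\neq 1$, and let $B$ be an abelian group of exponent $n\neq 1$. Then every critical group $K$ of the variety $\operatorname{var}(A)\operatorname{var}(B)$ is an extension of a group from $\operatorname{var}(A)$ by some direct product $U\times U^*$ from $\operatorname{var}(B)$, that is, $K$ has a normal subgroup $N\in\operatorname{var}(A)$ with $K/N\cong U\times U^*\in\operatorname{var}(B)$, such that 1. the orders of the non-trivial elements of $U$ are coprime to $m$; 2. $U$ can be presented as a direct product of at most $c$ cyclic groups; 3. every prime dividing the order of a non-trivial element of $U^*$ is a common divisor of $m$ and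 $n$. (When an exponent is $0$, every integer divides it, and only $1$ is coprime to it.) -/

import Mathlib

universe u v w

/-- A class of groups (in a fixed universe). -/
abbrev GroupClass : Type (u + 1) := (G : Type u) → [Group G] → Prop

/-- The group `G` satisfies the law `w = 1`: every substitution of elements of `G` for the
variables of the word `w` (in countably many variables) gives `1`. -/
def SatisfiesLaw (G : Type u) [Group G] (w : FreeGroup ℕ) : Prop :=
  ∀ φ : ℕ → G, FreeGroup.lift φ w = 1

/-- The variety generated by a class `X` of groups: all groups that satisfy every law
that holds in all members of `X`. -/
def varietyGeneratedBy (X : GroupClass.{u}) : GroupClass.{v} := fun G _ =>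
  ∀ w : FreeGroup ℕ, (∀ (H : Type u) [Group H], X H → SatisfiesLaw H w) → SatisfiesLaw G w

/-- `var(A)`, the variety generated by a single group `A`. -/
def varGroup (A : Type u) [Group A] : GroupClass.{v} :=
  varietyGeneratedBy.{u, v} (fun (G : Type u) [Group G] => Nonempty (G ≃* A))

/-- The product `𝔘𝔙`: all extensions of a group in `𝔘` by a group in `𝔙`. -/
def productVariety (𝔘 𝔙 : GroupClass.{u}) : GroupClass.{u} := fun G _ =>
  ∃ (N : Subgroup G) (_ : N.Normal), 𝔘 N ∧ 𝔙 (G ⧸ N)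

/-- The class of proper factors of `K` (up to isomorphism): the groups `H / N` with
`N ⊴ H ≤ K`, where `H = K` and `N = 1` do not hold together. -/
def ProperFactor (K : Type u) [Group K] : GroupClass.{u} := fun G _ =>
  ∃ (H : Subgroup K) (N : Subgroup H) (_ : N.Normal),
    ¬ (H = ⊤ ∧ N = ⊥) ∧ Nonempty (G ≃* H ⧸ N)

/-- A critical group: a finite group that is not in the variety generated by its
proper factors. -/
def IsCriticalGroup (K : Type u) [Group K] : Prop :=
  Finite K ∧ ¬ varietyGeneratedBy.{u, u} (ProperFactor K) K

/-- `U` is a direct product of at most `c` cyclic groups. -/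
def IsProductOfAtMostCyclic (c : ℕ) (U : Type u) [Group U] : Prop :=
  ∃ k : ℕ, k ≤ c ∧ ∃ (C : Fin k → Type u) (_ : ∀ i, Group (C i)),
    (∀ i, IsCyclic (C i)) ∧ Nonempty (U ≃* ((i : Fin k) → C i))

/-! Write `K` as an extension of `N ∈ var(A)` by an abelian group, and let `U`, `U*` be the parts of
`K / N` of order prime to `m` and of order involving only primes of `m`. Only the bound `c` on the
number of cyclic factors of `U` is deep.

`U` acts coprimely on `N`. An element of prime-power order centralizing every chief factor `N / W`
is central, and criticality excludes this for a nontrivial one when `N ≠ 1`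
(`IsCriticalGroup.inf_iInf_eq_bot`). By a Schur argument `K` acts on each `N / W` as a cyclic group,
so a minimal family of chief factors on which `U` is faithful embeds `U` in a product of `s` cyclic
groups.

To see `s ≤ c` (`IsCriticalGroup.irredundant_le`), take a minimal supplement `L` of `N`. The
subgroups `L W_i` are proper, while `K` is generated by elements lying in all of them and elements
of `N` lying in all but one. If `s > c`, evaluate a law of the proper subgroups on Host–Kra cubes
over these generators: the result vanishes at every vertex but the top, so its top value lies in
term `s` of a filtration built from the lower central series of `N`, which is trivial
(`IsCriticalGroup.closure_ne_top`). Then `K` satisfies every law of its proper factors, a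
contradiction. -/

open scoped commutatorElement

/-! ### Commutator filtrations and Host–Kra cubes -/

/-- A filtration of subgroups of `G`, whose commutators add degrees. -/
structure IsCommutatorFiltration {G : Type u} [Group G] (Γ : ℕ → Subgroup G) : Prop where
  succ_le : ∀ i, Γ (i + 1) ≤ Γ i
  commutator_mem : ∀ i j, ∀ x ∈ Γ i, ∀ y ∈ Γ j, ⁅x, y⁆ ∈ Γ (i + j)

namespace IsCommutatorFiltration

variable {G : Type u} [Group G] {Γ : ℕ → Subgroup G}

theorem antitone (h : IsCommutatorFiltration Γ) : Antitone Γ :=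
  antitone_nat_of_succ_le h.succ_le

theorem conj_mem (h : IsCommutatorFiltration Γ) {k i : ℕ} {g x : G} (hg : g ∈ Γ k)
    (hx : x ∈ Γ i) : g * x * g⁻¹ ∈ Γ i := by
  have h1 : ⁅g, x⁆ ∈ Γ i := h.antitone (Nat.le_add_left i k) (h.commutator_mem k i g hg x hx)
  have h2 : g * x * g⁻¹ = ⁅g, x⁆ * x := by simp [commutatorElement_def]
  exact h2 ▸ mul_mem h1 hx

/-- The filtration of `G × G` by pairs of degree `j` that agree up to degree `j + 1`. -/
def edge (h : IsCommutatorFiltration Γ) (j : ℕ) : Subgroup (G × G) where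
  carrier := {p | p.1 ∈ Γ j ∧ p.1⁻¹ * p.2 ∈ Γ (j + 1)}
  one_mem' := by simp
  mul_mem' := by
    rintro ⟨a, b⟩ ⟨c, d⟩ ⟨ha, hab⟩ ⟨hc, hcd⟩
    refine ⟨mul_mem ha hc, ?_⟩
    have h1 := h.conj_mem (inv_mem hc) hab
    have h2 : ((a, b) * (c, d) : G × G).1⁻¹ * ((a, b) * (c, d) : G × G).2
        = (c⁻¹ * (a⁻¹ * b) * c⁻¹⁻¹) * (c⁻¹ * d) := by
      simp [mul_assoc]
    exact h2 ▸ mul_mem h1 hcd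
  inv_mem' := by
    rintro ⟨a, b⟩ ⟨ha, hab⟩
    refine ⟨inv_mem ha, ?_⟩
    have h1 := h.conj_mem ha (inv_mem hab)
    have h2 : ((a, b)⁻¹ : G × G).1⁻¹ * ((a, b)⁻¹ : G × G).2 = a * (a⁻¹ * b)⁻¹ * a⁻¹ := by
      simp [mul_assoc]
    exact h2 ▸ h1

theorem mem_edge (h : IsCommutatorFiltration Γ) {j : ℕ} {p : G × G} :
    p ∈ h.edge j ↔ p.1 ∈ Γ j ∧ p.1⁻¹ * p.2 ∈ Γ (j + 1) := Iff.rfl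

/-- This drives the induction on dimension. For edges `(a, au)` and `(c, cv)`, the two commutators
differ by conjugates of `⁅u, cv⁆` and `⁅a, v⁆`, each one degree deeper. -/
theorem edge_isCommutatorFiltration (h : IsCommutatorFiltration Γ) :
    IsCommutatorFiltration h.edge where
  succ_le := fun i p hp => ⟨h.succ_le i hp.1, h.succ_le (i + 1) hp.2⟩
  commutator_mem := by
    rintro i j ⟨a, b⟩ ⟨ha, hab⟩ ⟨c, d⟩ ⟨hc, hcd⟩
    refine ⟨h.commutator_mem i j a ha c hc, ?_⟩
    dsimp only at *
    obtain ⟨u, rfl⟩ : ∃ u, b = a * u := ⟨a⁻¹ * b, by group⟩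
    obtain ⟨v, rfl⟩ : ∃ v, d = c * v := ⟨c⁻¹ * d, by group⟩
    rw [inv_mul_cancel_left] at hab hcd
    have hcv : c * v ∈ Γ j := mul_mem hc (h.succ_le j hcd)
    have h1 : ⁅u, c * v⁆ ∈ Γ (i + j + 1) := by
      have := h.commutator_mem _ _ _ hab _ hcv
      rwa [show i + 1 + j = i + j + 1 by ring] at this
    have h2 : ⁅a, v⁆ ∈ Γ (i + j + 1) := h.commutator_mem _ _ _ ha _ hcd
    have h3 : ⁅a, c⁆ ∈ Γ (i + j) := h.commutator_mem _ _ _ ha _ hc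
    have h4 : (⁅((a, a * u) : G × G), ((c, c * v) : G × G)⁆).1⁻¹
          * (⁅((a, a * u) : G × G), ((c, c * v) : G × G)⁆).2
        = (⁅a, c⁆⁻¹ * (a * ⁅u, c * v⁆ * a⁻¹) * ⁅a, c⁆⁻¹⁻¹) * (c * ⁅a, v⁆ * c⁻¹) := by
      simp only [commutatorElement_def, Prod.fst_mul, Prod.snd_mul, Prod.fst_inv, Prod.snd_inv]
      group
    rw [h4]
    exact mul_mem (h.conj_mem (inv_mem h3) (h.conj_mem ha h1)) (h.conj_mem hc h2)

/-- Constant cubes with a value of degree `0`, and cubes that are constant of degree `1` on one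
facet and trivial on the opposite one. -/
def basicCubes (Γ : ℕ → Subgroup G) (s : ℕ) : Set ((Fin s → Bool) → G) :=
  {f | (∃ g ∈ Γ 0, f = fun _ => g) ∨
    ∃ i : Fin s, ∃ g ∈ Γ 1, f = fun S => if S i then g else 1}

end IsCommutatorFiltration

open IsCommutatorFiltration

/-- Regard a cube of dimension `s + 1` as a cube of dimension `s` of edges. -/
def cubeOfEdges (G : Type u) [Group G] (s : ℕ) :
    ((Fin (s + 1) → Bool) → G) →* ((Fin s → Bool) → G × G) where
  toFun f S := (f (Fin.cons false S), f (Fin.cons true S))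
  map_one' := rfl
  map_mul' _ _ := rfl

/-- If a Host-Kra cube is trivial at all vertices but one, then its value there has degree at
least the dimension of the cube. -/
theorem apply_top_mem_of_mem_closure_basicCubes (s : ℕ) :
    ∀ {G : Type u} [Group G] {Γ : ℕ → Subgroup G}, IsCommutatorFiltration Γ →
      ∀ f ∈ Subgroup.closure (basicCubes Γ s), (∀ S : Fin s → Bool, (∃ i, S i = false) → f S = 1) →
        f (fun _ => true) ∈ Γ s := by
  induction s with
  | zero =>
    intro G _ Γ _ f hf hS
    clear hS
    induction hf using Subgroup.closure_induction with
    | mem x hx =>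
      rcases hx with ⟨g, hg, rfl⟩ | ⟨i, _⟩
      · exact hg
      · exact i.elim0
    | one => exact one_mem _
    | mul x y _ _ hx hy => exact mul_mem hx hy
    | inv x _ hx => exact inv_mem hx
  | succ s ih =>
    intro G _ Γ h f hf hS
    have hf' : cubeOfEdges G s f ∈ Subgroup.closure (basicCubes h.edge s) := by
      have hle : Subgroup.closure (basicCubes Γ (s + 1)) ≤
          (Subgroup.closure (basicCubes h.edge s)).comap (cubeOfEdges G s) := by
        rw [Subgroup.closure_le]
        rintro x (⟨g, hg, rfl⟩ | ⟨i, g, hg, rfl⟩)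
        · refine Subgroup.subset_closure (Or.inl ⟨(g, g), ?_, rfl⟩)
          exact h.mem_edge.2 ⟨hg, by simp⟩
        · refine Subgroup.subset_closure ?_
          induction i using Fin.cases with
          | zero =>
            -- The facet in the split-off direction becomes the constant edge `(1, g)`, of degree
            -- `0` because `g` has degree `1`.
            refine Or.inl ⟨(1, g), h.mem_edge.2 ⟨one_mem _, by simpa using hg⟩, ?_⟩
            ext S <;> simp [cubeOfEdges]
          | succ i =>
            refine Or.inr ⟨i, (g, g), h.mem_edge.2 ⟨hg, by simp⟩, ?_⟩
            ext S <;> simp only [cubeOfEdges, MonoidHom.coe_mk, OneHom.coe_mk, Fin.cons_succ] <;>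
              split <;> rfl
      exact hle hf
    have h1 := ih h.edge_isCommutatorFiltration _ hf' (by
      rintro S ⟨i, hi⟩
      exact Prod.ext (hS _ ⟨i.succ, by simpa using hi⟩) (hS _ ⟨i.succ, by simpa using hi⟩))
    -- The top edge is `(1, f ⊤)`; having edge degree `s` puts its quotient in degree `s + 1`.
    have h2 := (h.mem_edge.1 h1).2
    have h3 : (cubeOfEdges G s f (fun _ => true)).1 = 1 := hS _ ⟨0, by simp⟩
    have h4 : (cubeOfEdges G s f (fun _ => true)).2 = f (fun _ => true) := by
      change f _ = f _
      congr 1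
      ext i
      induction i using Fin.cases <;> simp
    rwa [h3, h4, inv_one, one_mul] at h2

/-! ### The filtration given by the lower central series of a normal subgroup -/

theorem commutator_commutator_le_of_rotate {G : Type u} [Group G] {H₁ H₂ H₃ M : Subgroup G}
    [M.Normal] (h1 : ⁅⁅H₂, H₃⁆, H₁⁆ ≤ M) (h2 : ⁅⁅H₃, H₁⁆, H₂⁆ ≤ M) : ⁅⁅H₁, H₂⁆, H₃⁆ ≤ M := by
  have key : ∀ A : Subgroup G, A ≤ M ↔ A.map (QuotientGroup.mk' M) = ⊥ := fun A => by
    rw [Subgroup.map_eq_bot_iff, QuotientGroup.ker_mk']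
  rw [key, Subgroup.map_commutator, Subgroup.map_commutator] at *
  exact Subgroup.commutator_commutator_eq_bot_of_rotate h1 h2

/-- Induction on `j` by the three subgroups lemma modulo the target. The shift by one arises because
the series starts at index `0` with `N`. -/
theorem commutator_lowerCentralSeries_le {G : Type u} [Group G] (N : Subgroup G) [N.Normal]
    (i j : ℕ) :
    ⁅N.lowerCentralSeries i, N.lowerCentralSeries j⁆ ≤ N.lowerCentralSeries (i + j + 1) := by
  induction j generalizing i with
  | zero => exact le_of_eq (by simp)
  | succ j ih =>
    rw [Subgroup.commutator_comm, Subgroup.lowerCentralSeries_succ]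
    refine commutator_commutator_le_of_rotate ?_ ?_
    · rw [Subgroup.commutator_comm N, ← Subgroup.lowerCentralSeries_succ]
      exact (ih (i + 1)).trans (le_of_eq (by congr 1; ring))
    · exact Subgroup.commutator_mono (ih i) le_rfl

/-- The group itself in degree `0`, followed by the lower central series of a normal subgroup. -/
def normalFiltration {G : Type u} [Group G] (N : Subgroup G) : ℕ → Subgroup G
  | 0 => ⊤
  | k + 1 => N.lowerCentralSeries k

theorem normalFiltration_isCommutatorFiltration {G : Type u} [Group G] (N : Subgroup G)
    [N.Normal] : IsCommutatorFiltration (normalFiltration N) where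
  succ_le
    | 0 => le_top
    | k + 1 => N.lowerCentralSeries_antitone k.le_succ
  commutator_mem
    | 0, 0, _, _, _, _ => Subgroup.mem_top _
    | 0, j + 1, x, _, y, hy => by
      rw [Nat.zero_add]
      exact Subgroup.commutator_le_right ⊤ (N.lowerCentralSeries j)
        (Subgroup.commutator_mem_commutator (Subgroup.mem_top x) hy)
    | i + 1, 0, x, hx, y, _ =>
      Subgroup.commutator_le_left (N.lowerCentralSeries i) ⊤
        (Subgroup.commutator_mem_commutator hx (Subgroup.mem_top y))
    | i + 1, j + 1, x, hx, y, hy => by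
      have := commutator_lowerCentralSeries_le N i j (Subgroup.commutator_mem_commutator hx hy)
      rw [show i + 1 + (j + 1) = (i + j + 1) + 1 by ring]
      exact this

/-! ### Laws in critical groups -/

theorem properFactor_subgroup {K : Type w} [Group K] {M : Subgroup K} (hM : M ≠ ⊤) :
    ProperFactor K M :=
  ⟨M, ⊥, inferInstance, fun h => hM h.1, ⟨QuotientGroup.quotientBot.symm⟩⟩

theorem properFactor_quotient {K : Type w} [Group K] {N : Subgroup K} [N.Normal] (hN : N ≠ ⊥) :
    ProperFactor K (K ⧸ N) := by
  refine ⟨⊤, N.subgroupOf ⊤, inferInstance, fun h => hN ?_,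
    ⟨(QuotientGroup.congr _ _ Subgroup.topEquiv ?_).symm⟩⟩
  · simpa using h.2
  · ext x
    simp [Subgroup.mem_map, Subgroup.mem_subgroupOf]

theorem SatisfiesLaw.lift_mem_eq_one {K : Type w} [Group K] {M : Subgroup K} {x : FreeGroup ℕ}
    (h : SatisfiesLaw M x) {φ : ℕ → K} (hφ : ∀ j, φ j ∈ M) : FreeGroup.lift φ x = 1 := by
  have h1 := congrArg M.subtype (h fun j => ⟨φ j, hφ j⟩)
  rw [map_one] at h1
  rw [← h1, ← MonoidHom.comp_apply]
  congr 1
  ext j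
  simp

/-- Otherwise `K` embeds in the product of the proper factors `K / N` and `K / M`: the value of a
law of both lies in `N ⊓ M`. -/
theorem IsCriticalGroup.disjoint_normal {K : Type w} [Group K] (hK : IsCriticalGroup K)
    {N M : Subgroup K} [N.Normal] [M.Normal] (h : N ⊓ M = ⊥) : N = ⊥ ∨ M = ⊥ := by
  by_contra! hne
  refine hK.2 fun x hx φ => ?_
  have key : ∀ L : Subgroup K, ∀ [L.Normal], L ≠ ⊥ → FreeGroup.lift φ x ∈ L := by
    intro L _ hL
    have h1 := hx _ (properFactor_quotient hL) fun j => QuotientGroup.mk' L (φ j)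
    rw [← QuotientGroup.ker_mk' L, MonoidHom.mem_ker, ← h1, ← MonoidHom.comp_apply]
    congr 1
    ext j
    simp
  have : FreeGroup.lift φ x ∈ N ⊓ M := ⟨key N hne.1, key M hne.2⟩
  rwa [h, Subgroup.mem_bot] at this

/-- A group generated by elements that lie in all but at most one of `s > c` proper subgroups, where
the exceptional generators lie in a normal subgroup of class at most `c`, is not critical. -/
theorem IsCriticalGroup.closure_ne_top {K : Type w} [Group K] (hK : IsCriticalGroup K)
    (N : Subgroup K) [N.Normal] {c s : ℕ} (hN : N.lowerCentralSeries c = ⊥) (hs : c < s)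
    (M : Fin s → Subgroup K) (hM : ∀ i, M i ≠ ⊤) :
    Subgroup.closure ({x | ∀ i, x ∈ M i} ∪ {x | x ∈ N ∧ ∃ i, ∀ j, j ≠ i → x ∈ M j}) ≠ ⊤ := by
  intro hgen
  refine hK.2 fun x hx φ => ?_
  -- Each `y` becomes the top value of a cube whose value at any vertex with `S i = false` lies in
  -- `M i`. An exceptional generator, outside at most `M i`, is switched off on that facet.
  have hcube : ∀ y : K, ∃ f ∈ Subgroup.closure (basicCubes (normalFiltration N) s),
      f (fun _ => true) = y ∧ ∀ S i, S i = false → f S ∈ M i := by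
    intro y
    have hy : y ∈ Subgroup.closure
      ({x | ∀ i, x ∈ M i} ∪ {x | x ∈ N ∧ ∃ i, ∀ j, j ≠ i → x ∈ M j}) := hgen ▸ Subgroup.mem_top y
    induction hy using Subgroup.closure_induction with
    | mem y hy =>
      rcases hy with hy | ⟨hyN, i, hy⟩
      · exact ⟨fun _ => y, Subgroup.subset_closure (Or.inl ⟨y, Subgroup.mem_top _, rfl⟩), rfl,
          fun _ i _ => hy i⟩
      · refine ⟨fun S => if S i then y else 1,
          Subgroup.subset_closure (Or.inr ⟨i, y, hyN, rfl⟩), by simp, fun S j hj => ?_⟩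
        by_cases hi : S i = true
        · simp only [hi, if_true]
          exact hy j (by rintro rfl; simp [hi] at hj)
        · simp only [hi]
          exact one_mem _
    | one => exact ⟨1, one_mem _, rfl, fun _ _ _ => one_mem _⟩
    | mul y z _ _ hy hz =>
      obtain ⟨f, hf, rfl, hf'⟩ := hy
      obtain ⟨g, hg, rfl, hg'⟩ := hz
      exact ⟨f * g, mul_mem hf hg, rfl, fun S i hi => mul_mem (hf' S i hi) (hg' S i hi)⟩
    | inv y _ hy =>
      obtain ⟨f, hf, rfl, hf'⟩ := hy
      exact ⟨f⁻¹, inv_mem hf, rfl, fun S i hi => inv_mem (hf' S i hi)⟩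
  choose F hF hFtop hFM using hcube
  set f : (Fin s → Bool) → K := FreeGroup.lift (fun j => F (φ j)) x with hf
  have hfS : ∀ S, f S = FreeGroup.lift (fun j => F (φ j) S) x := by
    intro S
    have : (Pi.evalMonoidHom (fun _ : Fin s → Bool => K) S).comp
        (FreeGroup.lift fun j => F (φ j)) = FreeGroup.lift fun j => F (φ j) S := by
      ext j
      simp
    rw [← this]
    rfl
  have hmem : f ∈ Subgroup.closure (basicCubes (normalFiltration N) s) := by
    have : (FreeGroup.lift fun j => F (φ j)).range ≤
        Subgroup.closure (basicCubes (normalFiltration N) s) := by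
      rw [FreeGroup.range_lift_eq_closure, Subgroup.closure_le]
      rintro _ ⟨j, rfl⟩
      exact hF (φ j)
    exact this ⟨x, rfl⟩
  have h1 := apply_top_mem_of_mem_closure_basicCubes s
    (normalFiltration_isCommutatorFiltration N) f hmem (by
      rintro S ⟨i, hi⟩
      rw [hfS]
      exact (hx _ (properFactor_subgroup (hM i))).lift_mem_eq_one fun j => hFM _ _ _ hi)
  obtain ⟨t, rfl⟩ : ∃ t, s = t + 1 := ⟨s - 1, by omega⟩
  -- Degree `t + 1` is lower central term `t`, and `c ≤ t`.
  have h2 : normalFiltration N (t + 1) = ⊥ :=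
    le_bot_iff.1 (hN ▸ N.lowerCentralSeries_antitone (Nat.lt_succ_iff.1 hs))
  rw [h2, Subgroup.mem_bot, hfS] at h1
  simpa only [hFtop] using h1

/-! ### Coprime action on a nilpotent normal subgroup -/

theorem commutatorElement_mul_left_eq {G : Type u} [Group G] (x y z : G) :
    ⁅x * y, z⁆ = x * ⁅y, z⁆ * x⁻¹ * ⁅x, z⁆ := by
  simp only [commutatorElement_def]; group

theorem commutatorElement_mul_right_eq {G : Type u} [Group G] (x y z : G) :
    ⁅x, y * z⁆ = ⁅x, y⁆ * (y * ⁅x, z⁆ * y⁻¹) := by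
  simp only [commutatorElement_def]; group

theorem commutatorElement_inv_left_eq {G : Type u} [Group G] (x z : G) :
    ⁅x⁻¹, z⁆ = x⁻¹ * ⁅x, z⁆⁻¹ * x := by
  simp only [commutatorElement_def]; group

/-- Fixed points of a coprime automorphism lift modulo a normal subgroup. -/
theorem exists_commute_mul_of_commutator_mem {K : Type w} [Group K] [Finite K] {D : Subgroup K}
    [D.Normal] {q a : ℕ} [Fact q.Prime] (hq : ¬ q ∣ Nat.card D) {h n : K} (hh : h ^ q ^ a = 1)
    (hn : ⁅n, h⁆ ∈ D) : ∃ d ∈ D, Commute (n * d) h := by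
  classical
  have hmem : ∀ d : D, n⁻¹ * h * n * d * h⁻¹ ∈ D := by
    intro d
    have e : n⁻¹ * h * n * d * h⁻¹ = (n⁻¹ * ⁅n, h⁆⁻¹ * n⁻¹⁻¹) * (h * d * h⁻¹) := by
      simp only [commutatorElement_def]; group
    rw [e]
    exact mul_mem (Subgroup.Normal.conj_mem inferInstance _ (inv_mem hn) _)
      (Subgroup.Normal.conj_mem inferInstance _ d.2 _)
  -- Conjugation by `h` on the coset `nD`, transported to `D`. Its order divides `q ^ a` and `q ∤
  -- |D|`, so it has a fixed point.
  let f : Function.End D := fun d => ⟨n⁻¹ * h * n * d * h⁻¹, hmem d⟩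
  have hpow : ∀ k : ℕ, ∀ d : D, (((f ^ k : Function.End D) d : D) : K) =
      n⁻¹ * h ^ k * n * d * (h ^ k)⁻¹ := by
    intro k
    induction k with
    | zero => intro d; simp [show (1 : Function.End D) d = d from rfl]
    | succ k ih =>
      intro d
      rw [pow_succ']
      change n⁻¹ * h * n * (((f ^ k : Function.End D) d : D) : K) * h⁻¹ = _
      rw [ih d]
      group
  have hf : f ^ q ^ a = 1 := by
    funext d
    apply Subtype.ext
    rw [hpow, hh]
    simp [show (1 : Function.End D) d = d from rfl]
  have : Fintype D := Fintype.ofFinite D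
  have hcard := Equiv.Perm.card_fixedPoints_modEq hf
  rw [← Nat.card_eq_fintype_card] at hcard
  have hne : Fintype.card (Function.fixedPoints f) ≠ 0 := by
    intro h0
    rw [h0] at hcard
    exact hq ((Nat.modEq_zero_iff_dvd).1 hcard)
  obtain ⟨⟨d, hd⟩⟩ := Fintype.card_pos_iff.1 (Nat.pos_of_ne_zero hne)
  refine ⟨d, d.2, ?_⟩
  have h1 : n⁻¹ * h * n * d * h⁻¹ = d := congrArg Subtype.val hd
  have h2 : h * n * d = n * (n⁻¹ * h * n * d * h⁻¹) * h := by group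
  change n * d * h = h * (n * d)
  rw [← mul_assoc h, h2, h1]

/-- The derived subgroup consists of nongenerators: a maximal subgroup is normal with nontrivial
solvable quotient, so it cannot supplement the derived subgroup. -/
theorem eq_top_of_sup_commutator_eq_top {G : Type u} [Group G] [Finite G] [Group.IsNilpotent G]
    {C : Subgroup G} (hC : C ⊔ commutator G = ⊤) : C = ⊤ := by
  by_contra hne
  obtain ⟨M, hM, hCM⟩ := (eq_top_or_exists_le_coatom C).resolve_left hne
  have hMn : M.Normal :=
    Subgroup.NormalizerCondition.normal_of_coatom M (Group.normalizerCondition_of_isNilpotent) hM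
  have : Nontrivial (G ⧸ M) := QuotientGroup.nontrivial_iff.2 hM.1
  have hlt : commutator (G ⧸ M) < ⊤ := Group.IsSolvable.commutator_lt_top_of_nontrivial (G ⧸ M)
  have hle : commutator G ≤ (commutator (G ⧸ M)).comap (QuotientGroup.mk' M) := by
    rw [← Subgroup.map_le_iff_le_comap, commutator_def, Subgroup.map_commutator]
    exact Subgroup.commutator_mono le_top le_top
  have hMle : M ≤ (commutator (G ⧸ M)).comap (QuotientGroup.mk' M) := by
    intro x hx
    rw [Subgroup.mem_comap, QuotientGroup.mk'_apply, (QuotientGroup.eq_one_iff x).2 hx]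
    exact one_mem _
  have htop : (commutator (G ⧸ M)).comap (QuotientGroup.mk' M) = ⊤ := by
    rw [eq_top_iff, ← hC]
    exact sup_le (hCM.trans hMle) hle
  refine hlt.ne ?_
  rw [← Subgroup.map_comap_eq_self_of_surjective (QuotientGroup.mk'_surjective M)
    (commutator (G ⧸ M)), htop, Subgroup.map_top_of_surjective _ (QuotientGroup.mk'_surjective M)]

/-- `W` is a normal subgroup of the ambient group properly contained in `N`, and `N / W` is a chief
factor. -/
structure IsMaximalNormalIn {K : Type w} [Group K] (W N : Subgroup K) : Prop where
  normal : W.Normal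
  lt : W < N
  eq_or_eq : ∀ X : Subgroup K, X.Normal → W ≤ X → X ≤ N → X = W ∨ X = N

theorem exists_isMaximalNormalIn {K : Type w} [Group K] [Finite K] {X N : Subgroup K}
    (hX : X.Normal) (hXN : X < N) : ∃ W, IsMaximalNormalIn W N ∧ X ≤ W := by
  obtain ⟨W, hXW, hW⟩ := Set.Finite.exists_le_maximal
    (Set.toFinite {Y : Subgroup K | Y.Normal ∧ Y < N}) (show X ∈ _ from ⟨hX, hXN⟩)
  refine ⟨W, ⟨hW.prop.1, hW.prop.2, fun Y hY hWY hYN => ?_⟩, hXW⟩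
  rcases hYN.lt_or_eq with h | h
  · exact Or.inl (le_antisymm (hW.le_of_ge ⟨hY, h⟩ hWY) hWY)
  · exact Or.inr h

/-- The elements of `N` whose commutator with `h` lies in `D`. -/
def centralizerMod {K : Type w} [Group K] (N D : Subgroup K) [D.Normal] (h : K) : Subgroup K where
  carrier := {x | x ∈ N ∧ ⁅x, h⁆ ∈ D}
  one_mem' := by simp
  mul_mem' := by
    rintro x y ⟨hx, hxh⟩ ⟨hy, hyh⟩
    refine ⟨mul_mem hx hy, ?_⟩
    rw [commutatorElement_mul_left_eq]
    exact mul_mem (Subgroup.Normal.conj_mem inferInstance _ hyh _) hxh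
  inv_mem' := by
    rintro x ⟨hx, hxh⟩
    refine ⟨inv_mem hx, ?_⟩
    rw [commutatorElement_inv_left_eq]
    simpa using Subgroup.Normal.conj_mem inferInstance _ (inv_mem hxh) x⁻¹

/-- As `K / N` is abelian, a conjugate of `h` differs from `h` by an element of `N`, which acts
trivially on `N / ⁅N, N⁆`. -/
theorem centralizerMod_commutator_normal {K : Type w} [Group K] {N : Subgroup K} [N.Normal]
    (hab : ∀ x y : K, ⁅x, y⁆ ∈ N) (h : K) : (centralizerMod N ⁅N, N⁆ h).Normal where
  conj_mem := by
    rintro x ⟨hx, hxh⟩ k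
    refine ⟨Subgroup.Normal.conj_mem inferInstance _ hx _, ?_⟩
    have e : ⁅k * x * k⁻¹, h⁆ = k * (⁅x, h⁆ * (h * ⁅x, ⁅h⁻¹, k⁻¹⁆⁆ * h⁻¹)) * k⁻¹ := by
      rw [← commutatorElement_mul_right_eq]
      simp only [commutatorElement_def]; group
    rw [e]
    exact Subgroup.Normal.conj_mem inferInstance _ (mul_mem hxh
      (Subgroup.Normal.conj_mem inferInstance _
        (Subgroup.commutator_mem_commutator hx (hab _ _)) _)) _

theorem not_dvd_card_of_le {K : Type w} [Group K] {D N : Subgroup K} {q : ℕ}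
    (hq : ¬ q ∣ Nat.card N) (hD : D ≤ N) : ¬ q ∣ Nat.card D :=
  fun hd => hq (hd.trans (Subgroup.card_dvd_of_le hD))

section Coprime

variable {K : Type w} [Group K] [Finite K] {N : Subgroup K} [N.Normal] {q a : ℕ} [Fact q.Prime]
  {h : K}

/-- Fixed points lift, so the centralizer of `h` in `N` covers `N / ⁅N, N⁆`, and the derived
subgroup consists of nongenerators. -/
theorem centralizes_of_centralizes_abelianization [Group.IsNilpotent N]
    (hq : ¬ q ∣ Nat.card N) (hh : h ^ q ^ a = 1) (hN : ∀ n ∈ N, ⁅n, h⁆ ∈ ⁅N, N⁆) :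
    ∀ n ∈ N, Commute n h := by
  let C : Subgroup K := N ⊓ Subgroup.centralizer {h}
  have hsup : C.subgroupOf N ⊔ commutator N = ⊤ := by
    rw [eq_top_iff]
    rintro ⟨n, hn⟩ -
    obtain ⟨d, hd, hcomm⟩ := exists_commute_mul_of_commutator_mem
      (not_dvd_card_of_le hq (Subgroup.commutator_le_left N N)) hh (hN n hn)
    have hdN : d ∈ N := Subgroup.commutator_le_left N N hd
    have hd' : (⟨d, hdN⟩ : N) ∈ commutator N := by
      rw [← Subgroup.map_subtype_commutator] at hd
      obtain ⟨d', hd', rfl⟩ := hd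
      exact hd'
    have hc : (⟨n * d, mul_mem hn hdN⟩ : N) ∈ C.subgroupOf N := by
      rw [Subgroup.mem_subgroupOf]
      exact ⟨mul_mem hn hdN, Subgroup.mem_centralizer_singleton_iff.2 hcomm⟩
    have e : (⟨n, hn⟩ : N) = ⟨n * d, mul_mem hn hdN⟩ * ⟨d, hdN⟩⁻¹ := by
      apply Subtype.ext; simp
    rw [e]
    exact Subgroup.mul_mem_sup hc (inv_mem hd')
  have htop := eq_top_of_sup_commutator_eq_top hsup
  intro n hn
  have : (⟨n, hn⟩ : N) ∈ C.subgroupOf N := htop ▸ Subgroup.mem_top _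
  exact Subgroup.mem_centralizer_singleton_iff.1 (Subgroup.mem_subgroupOf.1 this).2

theorem centralizes_of_centralizes_chief_factors [Group.IsNilpotent N]
    (hab : ∀ x y : K, ⁅x, y⁆ ∈ N) (hq : ¬ q ∣ Nat.card N) (hh : h ^ q ^ a = 1)
    (hW : ∀ W, IsMaximalNormalIn W N → ∀ n ∈ N, ⁅n, h⁆ ∈ W) : ∀ n ∈ N, Commute n h := by
  refine centralizes_of_centralizes_abelianization hq hh ?_
  set X := centralizerMod N ⁅N, N⁆ h with hX
  have hXn : X.Normal := centralizerMod_commutator_normal hab h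
  have hXN : X ≤ N := fun x hx => hx.1
  suffices X = N by
    intro n hn
    rw [← this] at hn
    exact hn.2
  by_contra hne
  obtain ⟨W, hWN, hXW⟩ := exists_isMaximalNormalIn hXn (lt_of_le_of_ne hXN hne)
  have := hWN.normal
  refine hWN.lt.not_ge fun n hn => ?_
  set D : Subgroup K := Subgroup.normalClosure {x | ∃ n ∈ N, ⁅n, h⁆ = x}
  -- `h` acts trivially on `N / D`, so each `n` is a fixed point times an element of `D`. Both
  -- factors lie in `W`, which contradicts `W < N`.
  have hDW : D ≤ W := Subgroup.normalClosure_le_normal (by rintro _ ⟨n, hn, rfl⟩; exact hW W hWN n hn)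
  obtain ⟨d, hd, hcomm⟩ := exists_commute_mul_of_commutator_mem
    (not_dvd_card_of_le hq (hDW.trans hWN.lt.le)) hh
    (Subgroup.subset_normalClosure ⟨n, hn, rfl⟩ : ⁅n, h⁆ ∈ D)
  have h1 : n * d ∈ X :=
    ⟨mul_mem hn (hWN.lt.le (hDW hd)), by rw [commutatorElement_eq_one_iff_commute.2 hcomm]; exact one_mem _⟩
  exact (Subgroup.mul_mem_cancel_right W (hDW hd)).1 (hXW h1)

/-- `⁅k, h⁆` lies in `N`, so it commutes with `h`; as `⁅k, h⁆ * h` is conjugate to `h`, the order of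
`⁅k, h⁆` divides both `q ^ a` and `|N|`. -/
theorem mem_center_of_centralizes_chief_factors [Group.IsNilpotent N]
    (hab : ∀ x y : K, ⁅x, y⁆ ∈ N) (hq : ¬ q ∣ Nat.card N) (hh : h ^ q ^ a = 1)
    (hW : ∀ W, IsMaximalNormalIn W N → ∀ n ∈ N, ⁅n, h⁆ ∈ W) : h ∈ Subgroup.center K := by
  rw [Subgroup.mem_center_iff]
  intro k
  have hc := centralizes_of_centralizes_chief_factors hab hq hh hW ⁅k, h⁆ (hab k h)
  have h1 : (⁅k, h⁆ * h) ^ q ^ a = 1 := by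
    rw [commutatorElement_def, inv_mul_cancel_right, conj_pow, hh]
    simp
  rw [hc.mul_pow, hh, mul_one] at h1
  have h2 : ⁅k, h⁆ = 1 := by
    rw [← orderOf_eq_one_iff]
    have hco : (q ^ a).Coprime (Nat.card N) :=
      Nat.Coprime.pow_left _ (((Fact.out : q.Prime).coprime_iff_not_dvd).2 hq)
    refine Nat.eq_one_of_dvd_coprimes hco (orderOf_dvd_of_pow_eq_one h1) ?_
    have := orderOf_dvd_natCard (⟨⁅k, h⁆, hab k h⟩ : N)
    rwa [Subgroup.orderOf_mk] at this
  exact commutatorElement_eq_one_iff_mul_comm.1 h2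

/-- In a minimal supplement of `N`, elements of order prime to `|N|` centralize the intersection
with `N`. -/
theorem commute_of_minimal_supplement (hab : ∀ x y : K, ⁅x, y⁆ ∈ N) (hq : ¬ q ∣ Nat.card N)
    {L : Subgroup K} (hL : L ⊔ N = ⊤) (hmin : ∀ L' ≤ L, L' ⊔ N = ⊤ → L' = L)
    (hhL : h ∈ L) (hh : h ^ q ^ a = 1) {n : K} (hnL : n ∈ L) (hn : n ∈ N) : Commute n h := by
  have hpg : IsPGroup q (Subgroup.zpowers (⟨h, hhL⟩ : L)) := by
    rw [IsPGroup.iff_card, Nat.card_zpowers]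
    obtain ⟨b, -, hb⟩ := (Nat.dvd_prime_pow Fact.out).1 (orderOf_dvd_of_pow_eq_one hh)
    exact ⟨b, by rw [Subgroup.orderOf_mk, hb]⟩
  obtain ⟨Q, hQ⟩ := hpg.exists_le_sylow
  set N₀ : Subgroup L := N.subgroupOf L
  have hnormal : (N₀ ⊔ (Q : Subgroup L)).Normal := by
    refine ⟨fun x hx k => ?_⟩
    have e : k * x * k⁻¹ = ⁅k, x⁆ * x := by simp [commutatorElement_def]
    rw [e]
    refine mul_mem (Subgroup.mem_sup_left ?_) hx
    rw [Subgroup.mem_subgroupOf]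
    exact hab k x
  -- Frattini argument in the normal subgroup `N₀ Q`. The normalizer of `Q` then supplements `N`, so
  -- by minimality it is all of `L`.
  have hfr : Subgroup.normalizer (Q : Set L) ⊔ N₀ = ⊤ := by
    have h1 := Sylow.normalizer_sup_eq_top' Q (le_sup_right : (Q : Subgroup L) ≤ N₀ ⊔ Q)
    rw [eq_top_iff, ← h1]
    exact sup_le le_sup_left (sup_le le_sup_right (Subgroup.le_normalizer.trans le_sup_left))
  have hmap : (Subgroup.normalizer (Q : Set L)).map L.subtype = L := by
    refine hmin _ (Subgroup.map_subtype_le _) ?_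
    rw [eq_top_iff, ← hL]
    refine sup_le ?_ le_sup_right
    have h1 := congrArg (Subgroup.map L.subtype) hfr
    rw [Subgroup.map_sup, ← MonoidHom.range_eq_map, Subgroup.range_subtype] at h1
    refine h1.ge.trans (sup_le_sup_left ?_ _)
    rintro _ ⟨x, hx, rfl⟩
    exact hx
  have htop : Subgroup.normalizer (Q : Set L) = ⊤ := by
    rw [eq_top_iff]
    rintro x -
    obtain ⟨y, hy, hyx⟩ := hmap.ge x.2
    rwa [← Subtype.ext hyx]
  have hQn : (Q : Subgroup L).Normal := Subgroup.normalizer_eq_top_iff.1 htop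
  have hdisj : Disjoint N₀ (Q : Subgroup L) := by
    refine Subgroup.disjoint_of_coprime_natCard ?_
    obtain ⟨b, hb⟩ := (IsPGroup.iff_card).1 Q.2
    rw [hb]
    refine (Nat.Coprime.pow_left _ (((Fact.out : q.Prime).coprime_iff_not_dvd).2 fun hd => hq ?_)).symm
    refine hd.trans ?_
    rw [← Subgroup.card_map_of_injective L.subtype_injective]
    exact Subgroup.card_dvd_of_le (by rintro _ ⟨x, hx, rfl⟩; exact hx)
  have := Subgroup.commute_of_normal_of_disjoint _ _ inferInstance hQn hdisj ⟨n, hnL⟩ ⟨h, hhL⟩ hn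
    (hQ (Subgroup.mem_zpowers _))
  exact congrArg Subtype.val this

end Coprime

/-! ### Abelian operator groups on chief factors -/

section Cyclic

variable {G : Type u} [Group G] (V : Subgroup G) [V.Normal]

/-- Conjugation on a normal subgroup `V`, as additive endomorphisms of `V` written additively. -/
def conjAddEnd (hV : IsMulCommutative V) :
    letI : CommGroup V := { (inferInstance : Group V) with mul_comm := hV.is_comm.comm }
    G →* AddMonoid.End (Additive V) :=
  letI : CommGroup V := { (inferInstance : Group V) with mul_comm := hV.is_comm.comm }
  { toFun := fun g => MonoidHom.toAdditive (MulAut.conjNormal g : MulAut V).toMonoidHom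
    map_one' := by
      rw [map_one]
      rfl
    map_mul' := fun g h => by
      rw [map_mul]
      rfl }

open scoped IsMulCommutative in
/-- An abelian group of automorphisms of a finite abelian group without proper invariant subgroups
is cyclic. -/
theorem isCyclic_quotient_centralizer_of_minimal [Finite G] (hV : IsMulCommutative V)
    (hne : V ≠ ⊥) (hmin : ∀ X ≤ V, X.Normal → X = ⊥ ∨ X = V) (hab : ∀ x y : G, ⁅x, y⁆ ∈ V) :
    IsCyclic (G ⧸ Subgroup.centralizer (V : Set G)) := by
  let _ : CommGroup V := { (inferInstance : Group V) with mul_comm := hV.is_comm.comm }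
  let φ : G →* AddMonoid.End (Additive V) := conjAddEnd V hV
  have hφ : ∀ (g : G) (x : Additive V), ((φ g x).toMul : G) = g * (x.toMul : G) * g⁻¹ :=
    fun g x => rfl
  have hext : ∀ a b : AddMonoid.End (Additive V), (∀ x, ((a x).toMul : G) = ((b x).toMul : G)) →
      a = b := fun a b h => by
    ext x
    exact h (Additive.ofMul x)
  have hker : ∀ g : G, φ g = 1 ↔ g ∈ Subgroup.centralizer (V : Set G) := by
    intro g
    rw [Subgroup.mem_centralizer_iff]
    constructor
    · intro h x hx
      have h1 := hφ g (Additive.ofMul (⟨x, hx⟩ : V))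
      rw [h] at h1
      change x = g * x * g⁻¹ at h1
      exact eq_mul_inv_iff_mul_eq.1 h1
    · intro h
      refine hext _ _ fun x => ?_
      rw [hφ, ← h _ x.toMul.2]
      simp
  have hcomm : ∀ g h : G, φ g * φ h = φ h * φ g := by
    intro g h
    have h1 : φ ⁅g, h⁆ = 1 := by
      rw [hker, Subgroup.mem_centralizer_iff]
      intro x hx
      exact congrArg Subtype.val (mul_comm (⟨x, hx⟩ : V) ⟨_, hab g h⟩)
    have h2 : g * h = ⁅g, h⁆ * (h * g) := by simp only [commutatorElement_def]; group
    rw [← map_mul, h2, map_mul, h1, one_mul, map_mul]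
  -- Schur's lemma: `R` is commutative and kernels of its elements are invariant, so nonzero
  -- elements are injective and `R` is a domain. Finite groups of units of a domain are cyclic.
  let R := Subring.closure (Set.range φ)
  have hcl : IsMulCommutative R := Subring.isMulCommutative_closure (by
    rintro _ ⟨g, rfl⟩ _ ⟨h, rfl⟩
    exact hcomm g h)
  have hφR : ∀ g, φ g ∈ R := fun g => Subring.subset_closure ⟨g, rfl⟩
  have hinj : ∀ b ∈ R, b ≠ 0 → Function.Injective b := by
    intro b hb hb0
    let X : Subgroup G :=
      { carrier := {g | ∃ hg : g ∈ V, b (Additive.ofMul ⟨g, hg⟩) = 0}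
        one_mem' := ⟨one_mem V, map_zero b⟩
        mul_mem' := by
          rintro x y ⟨hx, hx'⟩ ⟨hy, hy'⟩
          refine ⟨mul_mem hx hy, ?_⟩
          have := map_add b (Additive.ofMul ⟨x, hx⟩) (Additive.ofMul ⟨y, hy⟩)
          rw [hx', hy', add_zero] at this
          exact this
        inv_mem' := by
          rintro x ⟨hx, hx'⟩
          refine ⟨inv_mem hx, ?_⟩
          have := map_neg b (Additive.ofMul ⟨x, hx⟩)
          rw [hx', neg_zero] at this
          exact this }
    have hXn : X.Normal := by
      refine ⟨?_⟩
      rintro x ⟨hx, hx'⟩ g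
      refine ⟨Subgroup.Normal.conj_mem inferInstance _ hx _, ?_⟩
      have h1 : b * φ g = φ g * b :=
        congrArg Subtype.val (mul_comm (⟨b, hb⟩ : R) ⟨φ g, hφR g⟩)
      have h2 : (b * φ g) (Additive.ofMul ⟨x, hx⟩) = (φ g * b) (Additive.ofMul ⟨x, hx⟩) := by
        rw [h1]
      change b (φ g _) = φ g (b _) at h2
      rw [hx', map_zero] at h2
      exact h2
    rcases hmin X (fun x hx => hx.1) hXn with h | h
    · rw [injective_iff_map_eq_zero]
      intro x hx
      have : (x.toMul : G) ∈ X := ⟨x.toMul.2, hx⟩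
      rw [h, Subgroup.mem_bot] at this
      exact congrArg Additive.ofMul (Subtype.ext this)
    · refine absurd (hext _ _ fun x => ?_) hb0
      obtain ⟨_, h0⟩ := h.ge x.toMul.2
      exact congrArg (fun y : Additive V => (y.toMul : G)) h0
  have : Nontrivial V := (Subgroup.nontrivial_iff_ne_bot V).2 hne
  have hnt : Nontrivial R := by
    refine ⟨0, 1, fun h => ?_⟩
    obtain ⟨x, hx⟩ := exists_ne (0 : Additive V)
    have h1 : (0 : AddMonoid.End (Additive V)) = 1 := congrArg Subtype.val h
    exact hx (by simpa using (DFunLike.congr_fun h1 x).symm)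
  have hnz : NoZeroDivisors R := by
    refine ⟨?_⟩
    rintro ⟨a, ha⟩ ⟨b, hb⟩ hab0
    by_contra! hne0
    have ha0 : a ≠ 0 := fun h => hne0.1 (Subtype.ext h)
    have hb0 : b ≠ 0 := fun h => hne0.2 (Subtype.ext h)
    obtain ⟨x, hx⟩ := exists_ne (0 : Additive V)
    have h1 : a * b = 0 := congrArg Subtype.val hab0
    have h2 : a (b x) = 0 := by
      change (a * b) x = 0
      rw [h1]; rfl
    exact hx ((injective_iff_map_eq_zero b).1 (hinj b hb hb0) x
      ((injective_iff_map_eq_zero a).1 (hinj a ha ha0) _ h2))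
  have : IsDomain R := NoZeroDivisors.to_isDomain R
  let ψ : G →* R := φ.codRestrict R hφR
  have hψ : Subgroup.centralizer (V : Set G) = ψ.ker := by
    ext g
    rw [← hker, MonoidHom.mem_ker, Subtype.ext_iff]
    rfl
  refine isCyclic_of_injective_ringHom (QuotientGroup.lift _ ψ hψ.le) ?_
  rw [← MonoidHom.ker_eq_bot_iff, QuotientGroup.ker_lift, ← hψ, QuotientGroup.map_mk'_self]

end Cyclic

/-- An abelian group of operators acts on a chief factor as a cyclic group. -/
theorem IsMaximalNormalIn.exists_cyclic_quotient {K : Type w} [Group K] [Finite K]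
    {W N : Subgroup K} [N.Normal] [Group.IsNilpotent N] (hW : IsMaximalNormalIn W N)
    (hab : ∀ x y : K, ⁅x, y⁆ ∈ N) :
    ∃ (T : Subgroup (K ⧸ N)) (_ : T.Normal), (∀ k : K, (k : K ⧸ N) ∈ T ↔ ∀ n ∈ N, ⁅n, k⁆ ∈ W) ∧
      IsCyclic ((K ⧸ N) ⧸ T) := by
  have := hW.normal
  -- Otherwise `W` and `⁅N, N⁆` generate `N`, forcing `W = N`.
  have hNW : ⁅N, N⁆ ≤ W := by
    rcases hW.eq_or_eq (⁅N, N⁆ ⊔ W) inferInstance le_sup_right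
      (sup_le (Subgroup.commutator_le_left N N) hW.lt.le) with h | h
    · exact le_sup_left.trans h.le
    · exfalso
      have h1 : W.subgroupOf N ⊔ commutator N = ⊤ := by
        rw [← Subgroup.map_subtype_inj, Subgroup.map_sup, Subgroup.map_subtype_commutator,
          Subgroup.subgroupOf_map_subtype, inf_eq_left.2 hW.lt.le, sup_comm, h,
          ← MonoidHom.range_eq_map, Subgroup.range_subtype]
      have h2 := eq_top_of_sup_commutator_eq_top h1
      exact hW.lt.not_ge (Subgroup.subgroupOf_eq_top.1 h2)
  let π := QuotientGroup.mk' W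
  have hπ : ∀ x, π x = 1 ↔ x ∈ W := QuotientGroup.eq_one_iff
  have hsurj : Function.Surjective π := QuotientGroup.mk'_surjective W
  let V : Subgroup (K ⧸ W) := N.map π
  have hVn : V.Normal := Subgroup.Normal.map inferInstance π hsurj
  have hcent : ∀ k : K, π k ∈ Subgroup.centralizer (V : Set (K ⧸ W)) ↔ ∀ n ∈ N, ⁅n, k⁆ ∈ W := by
    intro k
    rw [Subgroup.mem_centralizer_iff]
    constructor
    · intro h n hn
      rw [← hπ, map_commutatorElement, commutatorElement_eq_one_iff_mul_comm]
      exact h _ ⟨n, hn, rfl⟩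
    · rintro h _ ⟨n, hn, rfl⟩
      rw [← commutatorElement_eq_one_iff_mul_comm, ← map_commutatorElement, hπ]
      exact h n hn
  have hcyc : IsCyclic ((K ⧸ W) ⧸ Subgroup.centralizer (V : Set (K ⧸ W))) := by
    refine isCyclic_quotient_centralizer_of_minimal V ?_ ?_ ?_ ?_
    · rw [← Subgroup.commutator_self_eq_bot_iff, ← Subgroup.map_commutator,
        Subgroup.map_eq_bot_iff, QuotientGroup.ker_mk']
      exact hNW
    · intro h
      rw [Subgroup.map_eq_bot_iff, QuotientGroup.ker_mk'] at h
      exact hW.lt.not_ge h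
    · intro X hX hXn
      have hle : W ≤ X.comap π := fun x hx => by
        rw [Subgroup.mem_comap, (hπ x).2 hx]; exact one_mem _
      have hle' : X.comap π ≤ N := by
        intro x hx
        obtain ⟨n, hn, hnx⟩ := hX hx
        have : n⁻¹ * x ∈ W := by rw [← hπ, map_mul, map_inv, hnx, inv_mul_cancel]
        exact (Subgroup.mul_mem_cancel_left N (inv_mem hn)).1 (hW.lt.le this)
      have hX' := Subgroup.map_comap_eq_self_of_surjective hsurj X
      rcases hW.eq_or_eq _ (hXn.comap π) hle hle' with h | h
      · left
        rw [← hX', h, Subgroup.map_eq_bot_iff, QuotientGroup.ker_mk']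
      · right
        rw [← hX', h]
    · intro x y
      obtain ⟨x, rfl⟩ := hsurj x
      obtain ⟨y, rfl⟩ := hsurj y
      exact ⟨_, hab x y, map_commutatorElement π x y⟩
  let ρ : K →* (K ⧸ W) ⧸ Subgroup.centralizer (V : Set (K ⧸ W)) := (QuotientGroup.mk' _).comp π
  have hρ : ∀ k, ρ k = 1 ↔ ∀ n ∈ N, ⁅n, k⁆ ∈ W := fun k => by
    rw [← hcent]; exact QuotientGroup.eq_one_iff (π k)
  have hNρ : N ≤ ρ.ker := fun x hx => by
    rw [MonoidHom.mem_ker, hρ]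
    exact fun n hn => hNW (Subgroup.commutator_mem_commutator hn hx)
  let σ := QuotientGroup.lift N ρ hNρ
  refine ⟨σ.ker, inferInstance, fun k => ?_, ?_⟩
  · rw [MonoidHom.mem_ker, ← hρ]; rfl
  · exact isCyclic_of_injective (QuotientGroup.kerLift σ) (QuotientGroup.kerLift_injective σ)

/-! ### Faithful irredundant families of chief factors -/

theorem exists_prime_orderOf_mem {G : Type u} [Group G] [Finite G] {S : Subgroup G} (hS : S ≠ ⊥) :
    ∃ q : ℕ, q.Prime ∧ ∃ x ∈ S, orderOf x = q := by
  have hcard : Nat.card S ≠ 1 := fun h => hS (Subgroup.card_eq_one.1 h)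
  have hq := Nat.minFac_prime hcard
  have : Fact (Nat.minFac (Nat.card S)).Prime := ⟨hq⟩
  obtain ⟨x, hx⟩ := exists_prime_orderOf_dvd_card' _ (Nat.minFac_dvd (Nat.card S))
  exact ⟨_, hq, x, x.2, by rw [← hx, Subgroup.orderOf_coe]⟩

/-- An element whose image has prime order `q` has a power of `q`-power order with the same
image. -/
theorem exists_pow_primePow_eq_one {G : Type u} {H : Type v} [Group G] [Finite G] [Group H]
    (f : G →* H) {q : ℕ} (hq : q.Prime) {l : G} (hl : orderOf (f l) = q) :
    ∃ j a : ℕ, (l ^ j) ^ q ^ a = 1 ∧ f (l ^ j) = f l := by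
  obtain ⟨a, r, hr, hlr⟩ := Nat.exists_eq_pow_mul_and_not_dvd (orderOf_pos l).ne' q hq.ne_one
  -- Raising to `r` kills the part of the order prime to `q`; `t` inverts `r` modulo `q`, restoring
  -- the image.
  obtain ⟨t, -, ht⟩ := Nat.exists_mul_mod_eq_one_of_coprime
    ((hq.coprime_iff_not_dvd.2 hr).symm) hq.one_lt
  refine ⟨r * t, a, ?_, ?_⟩
  · rw [← pow_mul, show r * t * q ^ a = orderOf l * t by rw [hlr]; ring, pow_mul,
      pow_orderOf_eq_one, one_pow]
  · rw [map_pow, ← pow_mod_orderOf, hl, ht, pow_one]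

theorem exists_minimal_supplement {K : Type w} [Group K] [Finite K] (N : Subgroup K) :
    ∃ L : Subgroup K, L ⊔ N = ⊤ ∧ ∀ L' ≤ L, L' ⊔ N = ⊤ → L' = L := by
  obtain ⟨L, hL⟩ := Set.Finite.exists_minimal (Set.toFinite {L : Subgroup K | L ⊔ N = ⊤})
    ⟨⊤, top_sup_eq N⟩
  exact ⟨L, hL.prop, fun L' hle hL' => le_antisymm hle (hL.le_of_le hL' hle)⟩

/-- In a critical group with nontrivial normal nilpotent `N` and abelian quotient `K / N`, a subgroup
of `K / N` of order prime to `|N|` acts faithfully on the chief factors `N / W`. -/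
theorem IsCriticalGroup.inf_iInf_eq_bot {K : Type w} [Group K] (hK : IsCriticalGroup K)
    {N : Subgroup K} [N.Normal] [Group.IsNilpotent N] (hN : N ≠ ⊥) (hab : ∀ x y : K, ⁅x, y⁆ ∈ N)
    {U : Subgroup (K ⧸ N)} (hU : ∀ x ∈ U, (orderOf x).Coprime (Nat.card N))
    {T : {W // IsMaximalNormalIn W N} → Subgroup (K ⧸ N)}
    (hT : ∀ W k, ((k : K) : K ⧸ N) ∈ T W ↔ ∀ n ∈ N, ⁅n, k⁆ ∈ W.1) : U ⊓ ⨅ W, T W = ⊥ := by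
  have := hK.1
  by_contra hne
  obtain ⟨q, hq, x, hxUT, hx⟩ := exists_prime_orderOf_mem hne
  obtain ⟨hxU, hxT⟩ := Subgroup.mem_inf.1 hxUT
  have : Fact q.Prime := ⟨hq⟩
  obtain ⟨l, rfl⟩ := QuotientGroup.mk'_surjective N x
  obtain ⟨j, a, hja, hjl⟩ := exists_pow_primePow_eq_one (QuotientGroup.mk' N) hq hx
  have hqN : ¬ q ∣ Nat.card N := (hq.coprime_iff_not_dvd).1 (hx ▸ hU _ hxU)
  have hcent : l ^ j ∈ Subgroup.center K := by
    refine mem_center_of_centralizes_chief_factors hab hqN hja fun W hW => ?_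
    refine (hT ⟨W, hW⟩ _).1 ?_
    change QuotientGroup.mk' N (l ^ j) ∈ _
    rw [hjl]
    exact Subgroup.mem_iInf.1 hxT _
  have hnorm : (Subgroup.zpowers (l ^ j)).Normal := ⟨fun x hx g => by
    rwa [(Subgroup.mem_center_iff.1 (Subgroup.zpowers_le.2 hcent hx) g), mul_inv_cancel_right]⟩
  have hdisj : N ⊓ Subgroup.zpowers (l ^ j) = ⊥ := by
    refine disjoint_iff.1 (Subgroup.disjoint_of_coprime_natCard ?_)
    rw [Nat.card_zpowers]
    exact (Nat.Coprime.coprime_dvd_left (orderOf_dvd_of_pow_eq_one hja)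
      (Nat.Coprime.pow_left a (hq.coprime_iff_not_dvd.2 hqN))).symm
  rcases hK.disjoint_normal hdisj with h | h
  · exact hN h
  · rw [Subgroup.zpowers_eq_bot] at h
    rw [← hjl, h, map_one, orderOf_one] at hx
    exact hq.one_lt.ne hx

/-- If `N` is covered modulo each `W i` by the intersection of the others, it is generated by these
intersections together with the intersection of all `W i`. -/
theorem le_of_irredundant {G : Type u} {ι : Type*} [Group G] [Finite ι] {N H : Subgroup G}
    {W : ι → Subgroup G} (hWn : ∀ i, (W i).Normal) (hW : ∀ i, W i ≤ N)
    (hcov : ∀ i, N ≤ (N ⊓ ⨅ j, ⨅ _ : j ≠ i, W j) ⊔ W i)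
    (hH : ∀ i, (N ⊓ ⨅ j, ⨅ _ : j ≠ i, W j) ≤ H) (hall : N ⊓ ⨅ i, W i ≤ H) : N ≤ H := by
  classical
  have := Fintype.ofFinite ι
  have key : ∀ t : Finset ι, N ≤ H ⊔ (N ⊓ ⨅ i ∈ t, W i) := by
    intro t
    induction t using Finset.induction_on with
    | empty => simp
    | insert i t hi ih =>
      refine ih.trans (sup_le le_sup_left ?_)
      intro n hn
      obtain ⟨hnN, hnt⟩ := Subgroup.mem_inf.1 hn
      have := hWn i
      -- Removing `d ∈ H` moves `n` into `W i` without leaving the other `W j`.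
      obtain ⟨d, hd, y, hy, rfl⟩ := Subgroup.mem_sup_of_normal_right.1 (hcov i hnN)
      refine Subgroup.mul_mem_sup (hH i hd) (Subgroup.mem_inf.2 ⟨hW i hy, ?_⟩)
      rw [Subgroup.mem_inf] at hd
      simp only [Subgroup.mem_iInf] at hnt hd ⊢
      intro j hj
      rcases Finset.mem_insert.1 hj with rfl | hj
      · exact hy
      · exact (Subgroup.mul_mem_cancel_left (W j)
          (hd.2 j (fun h => hi (h ▸ hj)))).1 (hnt j hj)
  have h := key Finset.univ
  simp only [Finset.mem_univ, iInf_pos] at h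
  exact h.trans (sup_le le_rfl hall)

/-- An irredundant family of chief factors `N / W i` detecting a coprime group of operators has at
most `c` members, if `N` has class at most `c` and the group is critical. -/
theorem IsCriticalGroup.irredundant_le {K : Type w} [Group K] (hK : IsCriticalGroup K)
    {N : Subgroup K} [N.Normal] {c : ℕ} (hc : N.lowerCentralSeries c = ⊥)
    (hab : ∀ x y : K, ⁅x, y⁆ ∈ N) {s : ℕ} {W : Fin s → Subgroup K}
    (hW : ∀ i, IsMaximalNormalIn (W i) N)
    {u : Fin s → K} {q : Fin s → ℕ} (hq : ∀ i, (q i).Prime)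
    (hu : ∀ i, orderOf (u i : K ⧸ N) = q i) (hqN : ∀ i, ¬ q i ∣ Nat.card N)
    (hne : ∀ i, ∃ n ∈ N, ⁅n, u i⁆ ∉ W i) (htriv : ∀ i j, j ≠ i → ∀ n ∈ N, ⁅n, u i⁆ ∈ W j) :
    s ≤ c := by
  have := hK.1
  by_contra! hs
  have : Group.IsNilpotent N := Subgroup.isNilpotent_of_lowerCentralSeries_eq_bot hc
  have hWn : ∀ i, (W i).Normal := fun i => (hW i).normal
  obtain ⟨L, hL, hLmin⟩ := exists_minimal_supplement N
  have hcongr : ∀ (i : Fin s) (x y : K), (x : K ⧸ N) = y → (∀ n ∈ N, ⁅n, x⁆ ∈ W i) →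
      ∀ n ∈ N, ⁅n, y⁆ ∈ W i := by
    intro i x y hxy hx n hn
    obtain ⟨T, -, hT, -⟩ := (hW i).exists_cyclic_quotient hab
    exact (hT y).1 (hxy ▸ (hT x).2 hx) n hn
  -- Otherwise `L ∩ N` covers `N / W i`, yet a lift of `u i` to `L` of prime-power order centralizes
  -- `L ∩ N`.
  have hM : ∀ i, L ⊔ W i ≠ ⊤ := by
    intro i htop
    have : Fact (q i).Prime := ⟨hq i⟩
    obtain ⟨l, hl, hlu⟩ : ∃ l ∈ L, (l : K ⧸ N) = u i := by
      obtain ⟨l, hl, n, hn, hln⟩ := Subgroup.mem_sup_of_normal_right.1 (hL.ge (Subgroup.mem_top (u i)))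
      refine ⟨l, hl, QuotientGroup.eq.2 ?_⟩
      rw [← hln, inv_mul_cancel_left]
      exact hn
    obtain ⟨j, a, hja, hjl⟩ := exists_pow_primePow_eq_one (QuotientGroup.mk' N) (hq i)
      (l := l) (by rw [← hu i, ← hlu]; rfl)
    obtain ⟨n, hn, hnu⟩ := hne i
    refine hnu (hcongr i (l ^ j) (u i) (hjl.trans hlu) ?_ n hn)
    intro n hn
    obtain ⟨y, hy, z, hz, rfl⟩ := Subgroup.mem_sup_of_normal_right.1 (htop.ge (Subgroup.mem_top n))
    have hyN : y ∈ N := (Subgroup.mul_mem_cancel_right N ((hW i).lt.le hz)).1 hn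
    have hcomm := commute_of_minimal_supplement hab (hqN i) hL hLmin (pow_mem hl j) hja hy hyN
    rw [commutatorElement_mul_left_eq, commutatorElement_eq_one_iff_commute.2 hcomm, mul_one]
    exact (hWn i).conj_mem _ (Subgroup.commutator_le_left (W i) ⊤
      (Subgroup.commutator_mem_commutator hz (Subgroup.mem_top _))) _
  refine hK.closure_ne_top N hc hs (fun i => L ⊔ W i) hM ?_
  set H := Subgroup.closure ({x | ∀ i, x ∈ L ⊔ W i} ∪
    {x | x ∈ N ∧ ∃ i, ∀ j, j ≠ i → x ∈ L ⊔ W j})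
  have hNH : N ≤ H := by
    refine le_of_irredundant hWn (fun i => (hW i).lt.le) ?_ ?_ ?_
    · intro i
      set D : Subgroup K := N ⊓ ⨅ j, ⨅ _ : j ≠ i, W j
      have hDn : D.Normal := by
        have : ∀ j, (⨅ _ : j ≠ i, W j).Normal := fun j => Subgroup.normal_iInf_normal fun _ => hWn j
        have : (⨅ j, ⨅ _ : j ≠ i, W j).Normal := Subgroup.normal_iInf_normal this
        infer_instance
      -- `D` contains every `⁅n, u i⁆`, and one of these is outside `W i`.
      rcases (hW i).eq_or_eq (D ⊔ W i) inferInstance le_sup_right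
        (sup_le inf_le_left (hW i).lt.le) with h | h
      · exfalso
        obtain ⟨n, hn, hnu⟩ := hne i
        refine hnu (h.le (Subgroup.mem_sup_left (Subgroup.mem_inf.2 ⟨hab _ _, ?_⟩)))
        simp only [Subgroup.mem_iInf]
        exact fun j hj => htriv i j hj n hn
      · exact h.ge
    · intro i x hx
      obtain ⟨hxN, hx⟩ := Subgroup.mem_inf.1 hx
      simp only [Subgroup.mem_iInf] at hx
      exact Subgroup.subset_closure (Or.inr ⟨hxN, i, fun j hj => Subgroup.mem_sup_right (hx j hj)⟩)
    · intro x hx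
      replace hx := (Subgroup.mem_inf.1 hx).2
      simp only [Subgroup.mem_iInf] at hx
      exact Subgroup.subset_closure (Or.inl fun i => Subgroup.mem_sup_right (hx i))
  rw [eq_top_iff, ← hL]
  exact sup_le (fun x hx => Subgroup.subset_closure (Or.inl fun i => Subgroup.mem_sup_left hx)) hNH

/-- Operators of order prime to `|N|` embed in a product of at most `c` cyclic groups. -/
theorem IsCriticalGroup.exists_embedding_pi_cyclic {K : Type w} [Group K]
    (hK : IsCriticalGroup K) {N : Subgroup K} [N.Normal] (hN : N ≠ ⊥) {c : ℕ}
    (hc : N.lowerCentralSeries c = ⊥) (hab : ∀ x y : K, ⁅x, y⁆ ∈ N) {U : Subgroup (K ⧸ N)}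
    (hU : ∀ x ∈ U, (orderOf x).Coprime (Nat.card N)) :
    ∃ s ≤ c, ∃ (C : Fin s → Type w) (_ : ∀ i, Group (C i)) (_ : ∀ i, Finite (C i))
      (_ : ∀ i, IsCyclic (C i)) (f : U →* ∀ i, C i), Function.Injective f := by
  classical
  have := hK.1
  have hnil : Group.IsNilpotent N := Subgroup.isNilpotent_of_lowerCentralSeries_eq_bot hc
  choose T hTn hT hTc using fun W : {W // IsMaximalNormalIn W N} =>
    W.2.exists_cyclic_quotient hab
  have hfin := Fintype.ofFinite {W // IsMaximalNormalIn W N}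
  obtain ⟨F, hF⟩ := Set.Finite.exists_minimal
    (Set.toFinite {F : Finset {W // IsMaximalNormalIn W N} | U ⊓ ⨅ W ∈ F, T W = ⊥})
    ⟨Finset.univ, by simpa using hK.inf_iInf_eq_bot hN hab hU hT⟩
  let e := F.equivFin.symm
  have hbot : U ⊓ ⨅ W ∈ F, T W = ⊥ := hF.prop
  -- By minimality, dropping one member of `F` leaves a nontrivial element of `U`, which may be
  -- taken of prime order.
  have hred : ∀ i, ∃ k : K, (k : K ⧸ N) ∈ U ∧ (orderOf (k : K ⧸ N)).Prime ∧
      (k : K ⧸ N) ∉ T (e i) ∧ ∀ j, j ≠ i → (k : K ⧸ N) ∈ T (e j) := by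
    intro i
    have hne : U ⊓ ⨅ W ∈ F.erase (e i), T W ≠ ⊥ := fun h =>
      Finset.notMem_erase (e i : {W // IsMaximalNormalIn W N}) F
        (hF.le_of_le h (Finset.erase_subset _ _) (e i).2)
    obtain ⟨q, hq, x, hxUT, hx⟩ := exists_prime_orderOf_mem hne
    obtain ⟨hxU, hxT⟩ := Subgroup.mem_inf.1 hxUT
    obtain ⟨k, rfl⟩ := QuotientGroup.mk_surjective x
    simp only [Subgroup.mem_iInf, Finset.mem_erase] at hxT
    refine ⟨k, hxU, hx ▸ hq, fun hki => ?_, fun j hj => hxT _ ⟨?_, (e j).2⟩⟩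
    · have hmem : (k : K ⧸ N) ∈ U ⊓ ⨅ W ∈ F, T W := by
        refine Subgroup.mem_inf.2 ⟨hxU, ?_⟩
        simp only [Subgroup.mem_iInf]
        intro W hWF
        by_cases h : W = e i
        · exact h ▸ hki
        · exact hxT W ⟨h, hWF⟩
      rw [hbot, Subgroup.mem_bot] at hmem
      rw [hmem, orderOf_one] at hx
      exact hq.one_lt.ne hx
    · exact fun h => hj (e.injective (Subtype.ext h))
  choose u huU hup hui huj using hred
  refine ⟨F.card, ?_, fun i => (K ⧸ N) ⧸ T (e i), fun i => inferInstance, fun i => inferInstance,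
    fun i => hTc _, MonoidHom.pi fun i => (QuotientGroup.mk' (T (e i))).comp U.subtype, ?_⟩
  · refine hK.irredundant_le hc hab (W := fun i => (e i).1.1) (fun i => (e i).1.2) hup
      (fun _ => rfl) (fun i => (hup i).coprime_iff_not_dvd.1 (hU _ (huU i))) (fun i => ?_)
      (fun i j hj => (hT _ _).1 (huj i j hj))
    by_contra! h
    exact hui i ((hT _ _).2 h)
  · rw [injective_iff_map_eq_one]
    intro x hx
    have hmem : (x : K ⧸ N) ∈ U ⊓ ⨅ W ∈ F, T W := by
      refine Subgroup.mem_inf.2 ⟨x.2, ?_⟩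
      simp only [Subgroup.mem_iInf]
      intro W hWF
      have h := congrFun hx (e.symm ⟨W, hWF⟩)
      have h' : (QuotientGroup.mk' (T (e (e.symm ⟨W, hWF⟩)))) x = 1 := h
      rw [QuotientGroup.mk'_apply, QuotientGroup.eq_one_iff, Equiv.apply_symm_apply] at h'
      exact h'
    rw [hbot, Subgroup.mem_bot] at hmem
    exact Subtype.ext hmem

/-! ### Decompositions of finite abelian groups -/

/-- A finite abelian group that embeds in an `s`-generated abelian group is a product of at most
`s` cyclic groups. -/
theorem exists_addEquiv_pi_zmod_of_injective {A P : Type*} [AddCommGroup A] [Finite A]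
    [AddCommGroup P] {s : ℕ} (p : (Fin s → ℤ) →+ P) (hp : Function.Surjective p) (f : A →+ P)
    (hf : Function.Injective f) :
    ∃ t ≤ s, ∃ d : Fin t → ℕ, Nonempty (A ≃+ ((i : Fin t) → ZMod (d i))) := by
  let p' := p.toIntLinearMap
  let f' := f.toIntLinearMap
  let M : Submodule ℤ (Fin s → ℤ) := (LinearMap.range f').comap p'
  let g : M →ₗ[ℤ] A := (LinearEquiv.ofInjective f' hf).symm.toLinearMap ∘ₗ
    p'.submoduleComap (LinearMap.range f')
  have hg : Function.Surjective g := by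
    rw [LinearMap.coe_comp]
    exact (LinearEquiv.ofInjective f' hf).symm.surjective.comp
      (LinearMap.submoduleComap_surjective_of_surjective p' (LinearMap.range f') hp)
  let e := g.quotKerEquivOfSurjective hg
  have hfin : Finite (M ⧸ LinearMap.ker g) := Finite.of_equiv A e.symm.toEquiv
  -- `M` is free of rank at most `s`, and the kernel has finite index, hence full rank in `M`; Smith
  -- normal form gives the cyclic factors.
  have hrank := Submodule.finiteQuotient_iff (LinearMap.ker g) |>.1 hfin
  refine ⟨Module.finrank ℤ M, ?_, _,
    ⟨e.symm.toAddEquiv.trans (Submodule.quotientEquivPiZMod _ (Module.finBasis ℤ M) hrank)⟩⟩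
  simpa using Submodule.finrank_le M

theorem isProductOfAtMostCyclic_of_embedding {U : Type w} [Group U] [Finite U] {s c : ℕ}
    (hsc : s ≤ c) {C : Fin s → Type v} [∀ i, Group (C i)] [∀ i, IsCyclic (C i)]
    (f : U →* ∀ i, C i) (hf : Function.Injective f) : IsProductOfAtMostCyclic c U := by
  let _ : ∀ i, CommGroup (C i) := fun i => IsCyclic.commGroup
  let _ : CommGroup U :=
    { (inferInstance : Group U) with mul_comm := fun x y => hf (by rw [map_mul, map_mul, mul_comm]) }
  choose g hg using fun i => IsCyclic.exists_generator (α := C i)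
  let p : (Fin s → ℤ) →+ Additive (∀ i, C i) :=
    { toFun := fun z => Additive.ofMul fun i => g i ^ z i
      map_zero' := by ext i; simp
      map_add' := fun y z => by ext i; simp [zpow_add] }
  have hp : Function.Surjective p := by
    intro x
    choose z hz using fun i => Subgroup.mem_zpowers_iff.1 (hg i (x.toMul i))
    exact ⟨z, funext hz⟩
  obtain ⟨t, hts, d, ⟨e⟩⟩ := exists_addEquiv_pi_zmod_of_injective p hp (MonoidHom.toAdditive f) hf
  refine ⟨t, hts.trans hsc, fun i => ULift (Multiplicative (ZMod (d i))), inferInstance,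
    fun i => isCyclic_of_surjective MulEquiv.ulift.symm.toMonoidHom MulEquiv.ulift.symm.surjective,
    ⟨?_⟩⟩
  refine MulEquiv.trans ?_ (MulEquiv.piCongrRight fun i => MulEquiv.ulift.symm)
  exact { toFun := fun u i => Multiplicative.ofAdd (e (Additive.ofMul u) i)
          invFun := fun z => (e.symm fun i => (z i).toAdd).toMul
          left_inv := fun u => by simp
          right_inv := fun z => by ext i; simp
          map_mul' := fun x y => by ext i; simp }

/-- For `m = 0` (infinite exponent) this forces `a = 1` and `b = k`. -/
theorem exists_coprime_factorization (m : ℕ) {k : ℕ} (hk : k ≠ 0) :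
    ∃ a b : ℕ, k = a * b ∧ a.Coprime m ∧ ∀ p : ℕ, p.Prime → p ∣ b → p ∣ m := by
  induction k using Nat.recOnMul with
  | zero => exact absurd rfl hk
  | one => exact ⟨1, 1, rfl, Nat.coprime_one_left m, fun p hp h => absurd h hp.not_dvd_one⟩
  | prime q hq =>
    by_cases h : q ∣ m
    · exact ⟨1, q, (one_mul q).symm, Nat.coprime_one_left m, fun p hp hpq =>
        (Nat.prime_dvd_prime_iff_eq hp hq).1 hpq ▸ h⟩
    · exact ⟨q, 1, (mul_one q).symm, hq.coprime_iff_not_dvd.2 h,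
        fun p hp h => absurd h hp.not_dvd_one⟩
  | mul x y hx hy =>
    obtain ⟨a, b, rfl, ha, hb⟩ := hx (left_ne_zero_of_mul hk)
    obtain ⟨a', b', rfl, ha', hb'⟩ := hy (right_ne_zero_of_mul hk)
    refine ⟨a * a', b * b', by ring, Nat.Coprime.mul_left ha ha', fun p hp h => ?_⟩
    exact (hp.dvd_mul.1 h).elim (hb p hp) (hb' p hp)

/-- A finite abelian group of order `a * b` with `a`, `b` coprime is the product of its subgroups
of exponents `a` and `b`. -/
theorem nonempty_mulEquiv_ker_pow_prod {G : Type u} [CommGroup G] {a b : ℕ}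
    (hab : a.Coprime b) (hG : ∀ x : G, x ^ (a * b) = 1) :
    Nonempty (G ≃* (powMonoidHom a : G →* G).ker × (powMonoidHom b : G →* G).ker) := by
  have hbez : (a : ℤ) * a.gcdA b + b * a.gcdB b = 1 := by
    rw [← Nat.gcd_eq_gcd_ab, hab]; rfl
  let f : (powMonoidHom a : G →* G).ker × (powMonoidHom b : G →* G).ker →* G :=
    MonoidHom.coprod (Subgroup.subtype _) (Subgroup.subtype _)
  refine ⟨(MulEquiv.ofBijective f ⟨?_, fun x => ?_⟩).symm⟩
  · rw [injective_iff_map_eq_one]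
    rintro ⟨⟨x, hx⟩, ⟨y, hy⟩⟩ h
    have hxy : x * y = 1 := h
    have hx' : x ^ a = 1 := hx
    have hy' : y ^ b = 1 := hy
    obtain rfl : x = y⁻¹ := eq_inv_of_mul_eq_one_left hxy
    rw [inv_pow, inv_eq_one] at hx'
    have : y = 1 := by
      rw [← orderOf_eq_one_iff]
      exact Nat.eq_one_of_dvd_coprimes hab (orderOf_dvd_of_pow_eq_one hx')
        (orderOf_dvd_of_pow_eq_one hy')
    simp [this]
  · have hx : ∀ z : ℤ, (x ^ z) ^ (a * b) = 1 := fun z => hG _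
    refine ⟨(⟨x ^ (b * a.gcdB b : ℤ), ?_⟩, ⟨x ^ (a * a.gcdA b : ℤ), ?_⟩), ?_⟩
    · rw [MonoidHom.mem_ker, powMonoidHom_apply, mul_comm (b : ℤ), zpow_mul, zpow_natCast,
        ← pow_mul, mul_comm b]
      exact hx _
    · rw [MonoidHom.mem_ker, powMonoidHom_apply, mul_comm (a : ℤ), zpow_mul, zpow_natCast,
        ← pow_mul]
      exact hx _
    · change x ^ (b * a.gcdB b : ℤ) * x ^ (a * a.gcdA b : ℤ) = x
      rw [← zpow_add, add_comm, hbez, zpow_one]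

/-! ### Laws inherited from the generating group -/

section Varieties

variable {A : Type u} [Group A]

theorem SatisfiesLaw.of_mulEquiv {G : Type v} {H : Type w} [Group G] [Group H] (e : G ≃* H)
    {x : FreeGroup ℕ} (h : SatisfiesLaw G x) : SatisfiesLaw H x := by
  intro φ
  have h1 := congrArg e (h fun j => e.symm (φ j))
  rw [map_one] at h1
  rw [← h1]
  change _ = (e.toMonoidHom.comp (FreeGroup.lift fun j => e.symm (φ j))) x
  congr 1
  ext j
  simp

theorem varGroup.satisfiesLaw {G : Type v} [Group G] (hG : varGroup A G) {x : FreeGroup ℕ}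
    (h : SatisfiesLaw A x) : SatisfiesLaw G x :=
  hG x fun _ _ ⟨e⟩ => h.of_mulEquiv e.symm

theorem varGroup.of_mulEquiv {G : Type v} {H : Type w} [Group G] [Group H] (hG : varGroup A G)
    (e : G ≃* H) : varGroup A H :=
  fun x hx => (hG x hx).of_mulEquiv e

theorem varGroup.pow_exponent_eq_one {G : Type v} [Group G] (hG : varGroup A G) (g : G) :
    g ^ Monoid.exponent A = 1 := by
  have h : SatisfiesLaw A (FreeGroup.of 0 ^ Monoid.exponent A) := fun φ => by
    rw [map_pow, Monoid.pow_exponent_eq_one]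
  simpa using hG.satisfiesLaw h fun _ => g

theorem varGroup.mul_comm {B : Type u} [CommGroup B] {G : Type v} [Group G] (hG : varGroup B G)
    (x y : G) : x * y = y * x := by
  have h : SatisfiesLaw B ⁅FreeGroup.of 0, FreeGroup.of 1⁆ := fun φ => by
    rw [map_commutatorElement, commutatorElement_eq_one_iff_mul_comm, _root_.mul_comm]
  have h1 := hG.satisfiesLaw h fun j => if j = 0 then x else y
  rw [map_commutatorElement, commutatorElement_eq_one_iff_mul_comm] at h1
  simpa using h1

/-- Countability makes `G` a quotient of the free group on `ℕ`, whose lower central term `c`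
consists of laws of `A`. -/
theorem varGroup.lowerCentralSeries_eq_bot {G : Type v} [Group G] [Countable G]
    (hG : varGroup A G) {c : ℕ} (hA : (⊤ : Subgroup A).lowerCentralSeries c = ⊥) :
    (⊤ : Subgroup G).lowerCentralSeries c = ⊥ := by
  obtain ⟨φ, hφ⟩ := exists_surjective_nat G
  have hsurj : Function.Surjective (FreeGroup.lift φ) := fun g => by
    obtain ⟨j, rfl⟩ := hφ g
    exact ⟨FreeGroup.of j, by simp⟩
  rw [← Subgroup.map_top_of_surjective _ hsurj, ← Subgroup.map_lowerCentralSeries, eq_bot_iff]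
  rintro _ ⟨x, hx, rfl⟩
  have h : SatisfiesLaw A x := fun ψ => by
    have h1 := Subgroup.lowerCentralSeries_mono c
      (le_top : (⊤ : Subgroup (FreeGroup ℕ)).map (FreeGroup.lift ψ) ≤ ⊤)
    dsimp only at h1
    rw [← Subgroup.map_lowerCentralSeries, hA] at h1
    exact Subgroup.mem_bot.1 (h1 ⟨x, hx, rfl⟩)
  exact Subgroup.mem_bot.2 (hG.satisfiesLaw h φ)

end Varieties

/-! ### Abelian critical groups and the conclusion -/

theorem IsCriticalGroup.isCyclic {K : Type w} [CommGroup K] (hK : IsCriticalGroup K) :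
    IsCyclic K := by
  classical
  have := hK.1
  obtain ⟨ι, _, n, hn, ⟨e⟩⟩ := CommGroup.equiv_prod_multiplicative_zmod_of_finite K
  rcases isEmpty_or_nonempty ι with _ | ⟨⟨i⟩⟩
  · have : Subsingleton K := e.toEquiv.subsingleton
    infer_instance
  · let ρ : K →* Multiplicative (ZMod (n i)) := (Pi.evalMonoidHom _ i).comp e.toMonoidHom
    let σ : Multiplicative (ZMod (n i)) →* K :=
      e.symm.toMonoidHom.comp (MonoidHom.mulSingle (fun i => Multiplicative (ZMod (n i))) i)
    have hρσ : ∀ x, ρ (σ x) = x := fun x => by simp [ρ, σ]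
    -- A nontrivial cyclic factor and its complement are disjoint, so the complement is trivial.
    have hinf : ρ.ker ⊓ σ.range = ⊥ := by
      rw [eq_bot_iff]
      rintro _ ⟨hx, ⟨y, rfl⟩⟩
      have h1 : ρ (σ y) = 1 := hx
      rw [hρσ] at h1
      rw [h1, map_one]
      exact one_mem _
    rcases hK.disjoint_normal hinf with h | h
    · exact isCyclic_of_injective ρ ((MonoidHom.ker_eq_bot_iff ρ).1 h)
    · exfalso
      have : Fact (1 < n i) := ⟨hn i⟩
      obtain ⟨y, hy⟩ := exists_ne (1 : Multiplicative (ZMod (n i)))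
      have h1 : σ y ∈ σ.range := ⟨y, rfl⟩
      rw [h, Subgroup.mem_bot] at h1
      exact hy (by rw [← hρσ y, h1, map_one])

/-- For `N = 1` there are no chief factors to act on; then `K` is abelian, hence cyclic, and `c ≥ 1`
suffices. -/
theorem IsCriticalGroup.isProductOfAtMostCyclic {K : Type w} [Group K] (hK : IsCriticalGroup K)
    {N : Subgroup K} [N.Normal] {c : ℕ} (hc0 : c ≠ 0) (hc : N.lowerCentralSeries c = ⊥)
    (hab : ∀ x y : K, ⁅x, y⁆ ∈ N) {U : Subgroup (K ⧸ N)}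
    (hU : ∀ x ∈ U, (orderOf x).Coprime (Nat.card N)) : IsProductOfAtMostCyclic c U := by
  have := hK.1
  by_cases hN : N = ⊥
  · let _ : CommGroup K :=
      { (inferInstance : Group K) with
        mul_comm := fun x y => commutatorElement_eq_one_iff_mul_comm.1
          (Subgroup.mem_bot.1 (hN ▸ hab x y)) }
    have h1 : IsCyclic K := hK.isCyclic
    have h2 : IsCyclic (K ⧸ N) := isCyclic_of_surjective _ (QuotientGroup.mk'_surjective N)
    refine isProductOfAtMostCyclic_of_embedding (s := 1) (Nat.one_le_iff_ne_zero.2 hc0)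
      (C := fun _ => K ⧸ N) (MonoidHom.pi fun _ => U.subtype) fun x y hxy => ?_
    exact Subtype.ext (congrFun hxy 0)
  · obtain ⟨s, hs, C, _, _, _, f, hf⟩ := hK.exists_embedding_pi_cyclic hN hc hab hU
    exact isProductOfAtMostCyclic_of_embedding hs f hf

theorem lemma2p1
    (A : Type u) [Group A] (B : Type v) [CommGroup B] (c m n : ℕ)
    (hA : Group.IsNilpotent A) (hc : Group.nilpotencyClass A = c)
    (hm : Monoid.exponent A = m) (hm1 : m ≠ 1)
    (hn : Monoid.exponent B = n) (hn1 : n ≠ 1)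
    (K : Type w) [Group K] (hcrit : IsCriticalGroup K)
    (hK : productVariety (varGroup A) (varGroup B) K) :
    ∃ (N : Subgroup K) (_ : N.Normal) (U Ustar : Type w) (_ : Group U) (_ : Group Ustar),
      varGroup A N ∧ varGroup B (U × Ustar) ∧ Nonempty (K ⧸ N ≃* U × Ustar) ∧
      (∀ x : U, x ≠ 1 → (orderOf x).Coprime m) ∧
      IsProductOfAtMostCyclic c U ∧
      (∀ x : Ustar, x ≠ 1 → ∀ p : ℕ, p.Prime → p ∣ orderOf x → p ∣ m ∧ p ∣ n) := by
  obtain ⟨N, hNn, hNA, hNB⟩ := hK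
  have := hcrit.1
  have hc0 : c ≠ 0 := by
    rintro rfl
    rw [Group.nilpotencyClass_zero_iff_subsingleton] at hc
    exact hm1 (hm ▸ Monoid.exp_eq_one_iff.2 hc)
  have hNc : N.lowerCentralSeries c = ⊥ := by
    rw [← Subgroup.top_subtype_lowerCentralSeries, hNA.lowerCentralSeries_eq_bot
      (hc ▸ Subgroup.lowerCentralSeries_nilpotencyClass), Subgroup.map_bot]
  have hab : ∀ x y : K, ⁅x, y⁆ ∈ N := fun x y => by
    rw [← QuotientGroup.eq_one_iff, ← QuotientGroup.mk'_apply, map_commutatorElement,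
      commutatorElement_eq_one_iff_mul_comm]
    exact hNB.mul_comm _ _
  let _ : CommGroup (K ⧸ N) := { (inferInstance : Group (K ⧸ N)) with mul_comm := hNB.mul_comm }
  -- `U` and `U*` will be the `a`-torsion and the `b`-torsion of `K / N`.
  obtain ⟨a, b, hcard, ham, hbm⟩ :=
    exists_coprime_factorization m (Nat.card_pos (α := K ⧸ N)).ne'
  have hab' : a.Coprime b := Nat.coprime_of_dvd fun p hp hpa hpb =>
    Nat.not_coprime_of_dvd_of_dvd hp.one_lt hpa (hbm p hp hpb) ham
  obtain ⟨e⟩ := nonempty_mulEquiv_ker_pow_prod (G := K ⧸ N) hab' fun x => by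
    rw [← hcard]; exact pow_card_eq_one'
  have hU : ∀ x ∈ (powMonoidHom a : K ⧸ N →* K ⧸ N).ker, orderOf x ∣ a :=
    fun x hx => orderOf_dvd_of_pow_eq_one hx
  refine ⟨N, hNn, (powMonoidHom a : K ⧸ N →* K ⧸ N).ker, (powMonoidHom b : K ⧸ N →* K ⧸ N).ker,
    inferInstance, inferInstance, hNA, hNB.of_mulEquiv e, ⟨e⟩, fun x _ => ?_, ?_,
    fun x _ p hp hpx => ⟨?_, ?_⟩⟩
  · rw [← Subgroup.orderOf_coe]
    exact ham.coprime_dvd_left (hU x x.2)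
  · refine hcrit.isProductOfAtMostCyclic hc0 hNc hab fun x hx => ?_
    -- By Cauchy, a prime dividing `|N|` is the order of an element of `N`, so it divides `m`.
    refine Nat.coprime_of_dvd fun p hp hpx hpN => ?_
    have : Fact p.Prime := ⟨hp⟩
    obtain ⟨y, hy⟩ := exists_prime_orderOf_dvd_card' p hpN
    refine Nat.not_coprime_of_dvd_of_dvd hp.one_lt (hpx.trans (hU x hx)) ?_ ham
    rw [← hy, ← hm]
    exact orderOf_dvd_of_pow_eq_one (hNA.pow_exponent_eq_one y)
  · refine hbm p hp (hpx.trans ?_)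
    rw [← Subgroup.orderOf_coe]
    exact orderOf_dvd_of_pow_eq_one x.2
  · refine hpx.trans ?_
    rw [← Subgroup.orderOf_coe, ← hn]
    exact orderOf_dvd_of_pow_eq_one (hNB.pow_exponent_eq_one _)
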